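/- Let $N\ge 1$ and let $\alpha_1,\dots,\alpha_N>0$ with $\sum_{i=1}^N\alpha_i=1$. Let $G$ be the union of $N$ half-lines $D_i=\{h\vec e_i : h\ge 0\}$ glued at their common origin $0$, with the metric $d(h\vec e_i,h'\vec e_i)=|h-h'|$ and $d(h\vec e_i,h'\vec e_j)=h+h'$ for $i\ne j$; write $|x|=d(x,0)$ and $f_i(h)=f(h\vec e_i)$ for $f:G\to\mathbb R$ and $h\ge 0$. Let $C_b^2(G^*)$ be the set of continuous $f:G\to\mathbb R$ (not necessarily bounded) such that each $f_i$ is twice differentiable on $(0,\infty)$ and $f_i',f_i''$ are continuous and bounded on $(0,\infty)$ and have finite limits at $0+$. For such $f$ let $f''(h\vec e_i)=f_i''(h)$ for $h>0$ and, by convention, $f''(0)=f_N''(0+)$. Let $$D(\alpha_1,\dots,\alpha_N)=\Big\{f\in C_b^2(G^*) : \sum_{i=1}^N\alpha_i f_i'(0+)=0\Big\}.$$ Let $Q=(Q_t)_{t\ge 0}$ be a Feller semigroup on $C_0(G)$, i.e. a strongly continuous semigroup of positive linear contractions of the space $C_0(G)$ of continuous real functions on $G$ vanishing at infinity. Let $Q_t(x,dy)$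 be the measures on $G$ representing it, and put $Q_tg(x)=\int g(y)\,Q_t(x,dy)$ for $Q_t(x,dy)$-integrable $g$. Suppose that for all $f\in D(\alpha_1,\dots,\alpha_N)$, $t\ge 0$ and $x\in G$, $f$ is $Q_t(x,dy)$-integrable and $$Q_tf(x)=f(x)+\frac12\int_0^tQ_uf''(x)\,du .$$ Then $Q$ is the semigroup of the Walsh Brownian motion $W(\alpha_1,\dots,\alpha_N)$: $Q_0$ is the identity and, for all $t>0$ and $f\in C_0(G)$, $$Q_tf(h\vec e_j)=2\sum_{i=1}^N\alpha_i\,p_tf_i(-h)+p_tf_j(h)-p_tf_j(-h)\quad(h>0,\ 1\le j\le N),\qquad Q_tf(0)=2\sum_{i=1}^N\alpha_i\,p_tf_i(0),$$ where $f_i$ is extended by $0$ to $(-\infty,0)$ and $p_tg(y)=\int_{\mathbb R}g(z)\,\frac{1}{\sqrt{2\pi t}}\,e^{-(z-y)^2/(2t)}\,dz$ is the heat semigroup of standard one-dimensional Brownian motion. -/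

import Mathlib

open Set Filter Topology MeasureTheory ProbabilityTheory
open scoped NNReal ZeroAtInfty CompactlySupported

noncomputable section

/-! ### The graph: `N` half-lines emanating from a common origin -/

/-- The union of the `N` half-lines `{h eᵢ : h ≥ 0}` in `ℝᴺ` with the `ℓ¹` norm. The induced distance
is `|h - h'|` between two points of one half-line and `h + h'` between points `h eᵢ`, `h' eⱼ`
with `i ≠ j` (see `StarGraph.dist_ray`). -/
def starSet (N : ℕ) : Set (PiLp 1 (fun _ : Fin N => ℝ)) :=
  {x | ∃ (i : Fin N) (h : ℝ≥0), x = WithLp.toLp 1 (Pi.single i (h : ℝ))}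

/-- The star graph `G` with `N` half-lines, with its metric and its Borel σ-algebra. -/
abbrev StarGraph (N : ℕ) : Type := ↥(starSet N)

theorem isClosed_starSet (N : ℕ) : IsClosed (starSet N) := by
  have key : starSet N = ⋃ i : Fin N,
      {x : PiLp 1 (fun _ : Fin N => ℝ) | 0 ≤ x i ∧ ∀ j, j ≠ i → x j = 0} := by
    ext x
    simp only [starSet, mem_ofPred_eq, mem_iUnion]
    constructor
    · rintro ⟨i, h, rfl⟩
      refine ⟨i, by simp, fun j hj => by simp [hj]⟩
    · rintro ⟨i, hi, hj⟩
      refine ⟨i, ⟨x i, hi⟩, ?_⟩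
      ext j
      by_cases hji : j = i
      · subst hji; exact (Pi.single_eq_same (M := fun _ : Fin N => ℝ) j (x j)).symm
      · simp [hji, hj j hji]
  rw [key]
  refine isClosed_iUnion_of_finite fun i => ?_
  have h1 : ∀ j : Fin N, Continuous fun x : PiLp 1 (fun _ : Fin N => ℝ) => x j :=
    fun j => by fun_prop
  refine (isClosed_le continuous_const (h1 i)).inter ?_
  have h2 : IsClosed (⋂ j : Fin N, ⋂ _ : j ≠ i,
      {x : PiLp 1 (fun _ : Fin N => ℝ) | x j = 0}) :=
    isClosed_iInter fun j => isClosed_iInter fun _ => isClosed_eq (h1 j) continuous_const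
  have h3 : (⋂ j : Fin N, ⋂ _ : j ≠ i, {x : PiLp 1 (fun _ : Fin N => ℝ) | x j = 0}) =
      {x : PiLp 1 (fun _ : Fin N => ℝ) | ∀ j, j ≠ i → x j = 0} := by
    ext x
    simp only [mem_iInter]
    rfl
  rw [h3] at h2
  exact h2

instance (N : ℕ) : LocallyCompactSpace (StarGraph N) :=
  (isClosed_starSet N).locallyCompactSpace

namespace StarGraph

variable {N : ℕ}

/-- The point `h eᵢ` at distance `h` from the origin on the `i`-th half-line. -/
def ray (i : Fin N) (h : ℝ≥0) : StarGraph N :=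
  ⟨WithLp.toLp 1 (Pi.single i (h : ℝ)), i, h, rfl⟩

theorem dist_ray (i j : Fin N) (h h' : ℝ≥0) :
    dist (ray i h) (ray j h') = if i = j then |(h : ℝ) - h'| else (h : ℝ) + h' := by
  rw [Subtype.dist_eq, PiLp.dist_eq_sum (by norm_num)]
  simp only [ray, ENNReal.toReal_one, Real.rpow_one, div_one, Real.dist_eq]
  split_ifs with hij
  · subst hij
    rw [Finset.sum_eq_single i]
    · simp
    · intro k _ hk; simp [hk]
    · simp
  · rw [← Finset.add_sum_erase _ _ (Finset.mem_univ i),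
      ← Finset.add_sum_erase _ _ (Finset.mem_erase.2 ⟨Ne.symm hij, Finset.mem_univ j⟩),
      Finset.sum_eq_zero]
    · simp [hij, Ne.symm hij]
    · intro k hk
      simp only [Finset.mem_erase] at hk
      simp [hk.1, hk.2.1]

variable [NeZero N]

/-- The origin of the graph, common to all the half-lines. -/
def origin : StarGraph N := ray ⊤ 0

/-- `|x|`, the distance from `x` to the origin. -/
def radius (x : StarGraph N) : ℝ := dist x origin

open Classical in
/-- The index `i` of the half-line containing `x`; at the origin, by convention, the last one. -/
def rayIndex (x : StarGraph N) : Fin N := if x = origin then ⊤ else x.2.choose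

end StarGraph

open StarGraph

/-! ### Functions on the graph -/

section Functions

variable {N : ℕ}

/-- The restriction `fᵢ(h) = f(h eᵢ)`, `h ≥ 0`, of `f` to the `i`-th half-line, extended by `0` to
the negative reals. -/
def onRay (f : StarGraph N → ℝ) (i : Fin N) : ℝ → ℝ :=
  fun h => if 0 ≤ h then f (ray i h.toNNReal) else 0

/-- `C_b²(G*)`: continuous functions on `G` whose restriction to every open half-line is twice
differentiable, with bounded continuous first and second derivatives that have finite limits at
`0+`. The function itself need not be bounded. -/
structure IsCb2 (f : StarGraph N → ℝ) : Prop where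
  continuous : Continuous f
  diff : ∀ i, DifferentiableOn ℝ (onRay f i) (Ioi 0)
  diff' : ∀ i, DifferentiableOn ℝ (deriv (onRay f i)) (Ioi 0)
  continuousOn_deriv : ∀ i, ContinuousOn (deriv (onRay f i)) (Ioi 0)
  continuousOn_deriv2 : ∀ i, ContinuousOn (deriv (deriv (onRay f i))) (Ioi 0)
  bounded_deriv : ∀ i, ∃ C : ℝ, ∀ h : ℝ, 0 < h → |deriv (onRay f i) h| ≤ C
  bounded_deriv2 : ∀ i, ∃ C : ℝ, ∀ h : ℝ, 0 < h → |deriv (deriv (onRay f i)) h| ≤ C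
  tendsto_deriv : ∀ i, ∃ l : ℝ, Tendsto (deriv (onRay f i)) (𝓝[>] 0) (𝓝 l)
  tendsto_deriv2 : ∀ i, ∃ l : ℝ, Tendsto (deriv (deriv (onRay f i))) (𝓝[>] 0) (𝓝 l)

/-- `fᵢ'(0+)`, the limit at `0+` of the derivative of `f` along the `i`-th half-line. -/
def derivZero (f : StarGraph N → ℝ) (i : Fin N) : ℝ :=
  limUnder (𝓝[>] (0 : ℝ)) (deriv (onRay f i))

/-- `fᵢ''(0+)`, the limit at `0+` of the second derivative of `f` along the `i`-th half-line. -/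
def deriv2Zero (f : StarGraph N → ℝ) (i : Fin N) : ℝ :=
  limUnder (𝓝[>] (0 : ℝ)) (deriv (deriv (onRay f i)))

/-- `D(α₁, …, α_N)`. -/
def walshDomain (α : Fin N → ℝ) : Set (StarGraph N → ℝ) :=
  {f | IsCb2 f ∧ ∑ i, α i * derivZero f i = 0}

open Classical in
/-- The function `f''` on `G`: `f''(h eᵢ) = fᵢ''(h)` for `h > 0`, and `f''(0) = f_N''(0+)`. -/
def secondDeriv [NeZero N] (f : StarGraph N → ℝ) : StarGraph N → ℝ := fun x =>
  if x = origin then deriv2Zero f ⊤ else deriv (deriv (onRay f (rayIndex x))) (radius x)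

end Functions

/-! ### Feller semigroups on `C₀(E)` -/

/-- A Feller semigroup on `C₀(E)`: a strongly continuous semigroup of positive linear contractions
of `C₀(E)`. Conservativeness is not required. -/
structure FellerSemigroup (E : Type*) [TopologicalSpace E] where
  /-- The operator at time `t`. -/
  op : ℝ≥0 → C₀(E, ℝ) →L[ℝ] C₀(E, ℝ)
  op_zero : op 0 = ContinuousLinearMap.id ℝ C₀(E, ℝ)
  op_add : ∀ s t, op (s + t) = (op s).comp (op t)
  nonneg : ∀ t (f : C₀(E, ℝ)), (∀ x, 0 ≤ f x) → ∀ x, 0 ≤ op t f x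
  contraction : ∀ t (f : C₀(E, ℝ)), ‖op t f‖ ≤ ‖f‖
  strong_continuity : ∀ f : C₀(E, ℝ), Tendsto (fun t => op t f) (𝓝 0) (𝓝 f)

namespace FellerSemigroup

variable {E : Type*} [TopologicalSpace E]

/-- The positive linear functional `f ↦ Q_t f(x)` on compactly supported continuous functions. -/
def evalFunctional (Q : FellerSemigroup E) (t : ℝ≥0) (x : E) : C_c(E, ℝ) →ₚ[ℝ] ℝ :=
  PositiveLinearMap.mk₀
    { toFun := fun f => Q.op t (f : C₀(E, ℝ)) x
      map_add' := fun f g => by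
        have h : ((f + g : C_c(E, ℝ)) : C₀(E, ℝ)) = (f : C₀(E, ℝ)) + (g : C₀(E, ℝ)) := by
          ext y; rfl
        rw [h, map_add]; rfl
      map_smul' := fun c f => by
        have h : ((c • f : C_c(E, ℝ)) : C₀(E, ℝ)) = c • (f : C₀(E, ℝ)) := by
          ext y; rfl
        rw [h, map_smul]; rfl }
    (fun f hf => Q.nonneg t _ (fun y => hf y) x)

/-- The transition measure `Q_t(x, dy)`, the (Riesz) measure on `E` representing `f ↦ Q_t f(x)`. -/
def transition [T2Space E] [LocallyCompactSpace E] [MeasurableSpace E] [BorelSpace E]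
    (Q : FellerSemigroup E) (t : ℝ≥0) (x : E) : Measure E :=
  RealRMK.rieszMeasure (Q.evalFunctional t x)

end FellerSemigroup

/-! ### Walsh Brownian motion -/

/-- `p_t g (y)`: the heat semigroup of standard one-dimensional Brownian motion. -/
def heat (t : ℝ≥0) (g : ℝ → ℝ) (y : ℝ) : ℝ := ∫ z, g z ∂(gaussianReal y t)

open Classical in
/-- The semigroup `P_t` of the Walsh Brownian motion `W(α₁, …, α_N)`. For `t > 0`,
`P_t f(h eⱼ) = 2 ∑ᵢ αᵢ p_t fᵢ(-h) + p_t fⱼ(h) - p_t fⱼ(-h)` if `h > 0`, and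
`P_t f(0) = 2 ∑ᵢ αᵢ p_t fᵢ(0)`. -/
def walshSemigroup {N : ℕ} [NeZero N] (α : Fin N → ℝ) (t : ℝ≥0) (f : StarGraph N → ℝ)
    (x : StarGraph N) : ℝ :=
  if t = 0 then f x
  else if x = origin then 2 * ∑ i, α i * heat t (onRay f i) 0
  else 2 * ∑ i, α i * heat t (onRay f i) (-radius x)
    + heat t (onRay f (rayIndex x)) (radius x) - heat t (onRay f (rayIndex x)) (-radius x)

end

/-! ### Families of measures on the line with vanishing weighted characteristic functions -/

section WeightedFamilies

variable {ι : Type*} [Fintype ι]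

/-! The domain contains enough eigenfunctions of `f''` to determine the transition measures. If `∑
αᵢ Aᵢ = 0`, the function equal to `Aᵢ sin (s h) + B cos (s h)` on ray `i` lies in `D(α)` and has
second derivative `-s²` times itself. Its integral against `Q_t(x, dy)` is bounded in `t` and solves
a linear Volterra equation, hence equals `exp (-s² t / 2)` times its value at `x`. The case `s = 0`
gives total mass one.

This factor is also the one by which a Gaussian law of variance `t` damps sines and cosines, so
uniqueness of characteristic functions identifies integrals against `Q_t(x, dy)` with Gaussian ones.
Let `g` be bounded and zero on `(-∞, 0]`, and put `P± = p_t g(±|x|)`. Pure cosines give the radial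
law (`sum_integral_coord`): the integrals of `g` over all rays sum to `P+ + P-`. Sines with
coefficients `δᵢⱼ - αᵢ` give the excess of ray `i` over its share `αᵢ` of that sum
(`integral_coord_sub`): it is `(δ - αᵢ)(P+ - P-)`, with `δ = 1` if `x` is on ray `i` and `0`
otherwise. Adding, ray `i` contributes `2 αᵢ P- + δ (P+ - P-)`, which is Walsh's formula. A general
`f` is its value at the origin plus functions of single coordinates that vanish at `0`. -/

theorem integral_sum_ofReal_smul {a : ι → ℝ} (ha : ∀ k, 0 ≤ a k) (μ : ι → Measure ℝ)
    {E : Type*} [NormedAddCommGroup E] [NormedSpace ℝ E] {g : ℝ → E}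
    (hg : ∀ k, Integrable g (μ k)) :
    ∫ z, g z ∂(∑ k, ENNReal.ofReal (a k) • μ k) = ∑ k, a k • ∫ z, g z ∂(μ k) := by
  rw [integral_finsetSum_measure
    fun k _ => (hg k).smul_measure ENNReal.ofReal_ne_top]
  refine Finset.sum_congr rfl fun k _ => ?_
  rw [integral_smul_measure, ENNReal.toReal_ofReal (ha k)]

theorem isFiniteMeasure_sum_ofReal_smul (a : ι → ℝ) (μ : ι → Measure ℝ)
    [∀ k, IsFiniteMeasure (μ k)] :
    IsFiniteMeasure (∑ k, ENNReal.ofReal (a k) • μ k) := by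
  refine ⟨?_⟩
  rw [Measure.finsetSum_apply]
  refine ENNReal.sum_lt_top.2 fun k _ => ?_
  exact ENNReal.mul_lt_top ENNReal.ofReal_lt_top (measure_lt_top _ _)

theorem integrable_exp_mul_I (μ : Measure ℝ) [IsFiniteMeasure μ] (s : ℝ) :
    Integrable (fun z : ℝ => Complex.exp (s * z * Complex.I)) μ := by
  refine Integrable.of_bound (by fun_prop) 1 (ae_of_all _ fun z => ?_)
  rw [← Complex.ofReal_mul, Complex.norm_exp_ofReal_mul_I]

/-- A real combination of finite measures whose characteristic function vanishes integrates every
bounded measurable function to zero. -/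
theorem sum_mul_integral_eq_zero_of_charFun (a : ι → ℝ) (μ : ι → Measure ℝ)
    [∀ k, IsFiniteMeasure (μ k)] (h : ∀ s, ∑ k, (a k : ℂ) * charFun (μ k) s = 0)
    {g : ℝ → ℝ} (hg : ∀ k, Integrable g (μ k)) : ∑ k, a k * ∫ z, g z ∂(μ k) = 0 := by
  -- Positive and negative parts of the coefficients turn the hypothesis into equality of the
  -- characteristic functions of two positive finite measures.
  have hsplit : ∀ k, a k = max (a k) 0 - max (-a k) 0 := fun k => by
    rcases le_total 0 (a k) with h | h <;> simp [h]
  have hp : ∀ k, 0 ≤ max (a k) 0 := fun k => le_max_right _ _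
  have hn : ∀ k, 0 ≤ max (-a k) 0 := fun k => le_max_right _ _
  have := isFiniteMeasure_sum_ofReal_smul (fun k => max (a k) 0) μ
  have := isFiniteMeasure_sum_ofReal_smul (fun k => max (-a k) 0) μ
  have key : ∑ k, ENNReal.ofReal (max (a k) 0) • μ k
      = ∑ k, ENNReal.ofReal (max (-a k) 0) • μ k := by
    refine Measure.ext_of_charFun (funext fun s => ?_)
    rw [charFun_apply_real, charFun_apply_real,
      integral_sum_ofReal_smul hp μ fun k => integrable_exp_mul_I (μ k) s,
      integral_sum_ofReal_smul hn μ fun k => integrable_exp_mul_I (μ k) s,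
      ← sub_eq_zero, ← Finset.sum_sub_distrib, ← h s]
    refine Finset.sum_congr rfl fun k _ => ?_
    rw [← sub_smul, ← hsplit, charFun_apply_real, Complex.real_smul]
  have h2 := integral_sum_ofReal_smul hp μ hg
  rw [key, integral_sum_ofReal_smul hn μ hg, eq_comm, ← sub_eq_zero,
    ← Finset.sum_sub_distrib] at h2
  rw [← h2]
  refine Finset.sum_congr rfl fun k _ => ?_
  rw [← sub_smul, ← hsplit, smul_eq_mul]

/-- Adjoining the reflected measures with weights `ε * a k` reduces this to vanishing characteristic
functions; `ε = 1` gives the even case and `ε = -1` the odd one. -/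
theorem sum_mul_integral_add_mul_neg_eq_zero (ε : ℝ) (a : ι → ℝ) (μ : ι → Measure ℝ)
    [∀ k, IsFiniteMeasure (μ k)]
    (h : ∀ s, ∑ k, (a k : ℂ) * (charFun (μ k) s + ε * charFun (μ k) (-s)) = 0)
    {g : ℝ → ℝ} (hg : Measurable g) {C : ℝ} (hC : ∀ z, |g z| ≤ C) :
    ∑ k, a k * ∫ z, (g z + ε * g (-z)) ∂(μ k) = 0 := by
  have hi : ∀ (ν : Measure ℝ) [IsFiniteMeasure ν], Integrable g ν := fun ν _ =>
    Integrable.of_bound hg.aestronglyMeasurable C (ae_of_all _ hC)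
  have hi' : ∀ (ν : Measure ℝ) [IsFiniteMeasure ν], Integrable (fun z => g (-z)) ν := fun ν _ =>
    Integrable.of_bound (hg.comp measurable_neg).aestronglyMeasurable C (ae_of_all _ fun z => hC _)
  let ν : ι ⊕ ι → Measure ℝ := Sum.elim μ fun k => (μ k).map (fun z => -z)
  have hν : ∀ k, IsFiniteMeasure (ν k) := by
    rintro (k | k)
    · exact inferInstanceAs (IsFiniteMeasure (μ k))
    · exact inferInstanceAs (IsFiniteMeasure ((μ k).map (fun z => -z)))
  have := sum_mul_integral_eq_zero_of_charFun (Sum.elim a fun k => ε * a k) ν (fun s => ?_)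
    (g := g) (fun k => hi _)
  · rw [Fintype.sum_sum_type, ← Finset.sum_add_distrib] at this
    rw [← this]
    refine Finset.sum_congr rfl fun k _ => ?_
    rw [integral_add (hi _) ((hi' _).const_mul _), integral_const_mul]
    simp only [ν, Sum.elim_inl, Sum.elim_inr]
    rw [integral_map measurable_neg.aemeasurable hg.aestronglyMeasurable]
    ring
  · rw [Fintype.sum_sum_type, ← Finset.sum_add_distrib, ← h s]
    refine Finset.sum_congr rfl fun k _ => ?_
    have : charFun ((μ k).map (fun z => -z)) s = charFun (μ k) (-s) := by
      rw [charFun_apply_real, charFun_apply_real,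
        integral_map measurable_neg.aemeasurable (by fun_prop)]
      simp
    simp only [ν, Sum.elim_inl, Sum.elim_inr, this]
    push_cast
    ring

theorem charFun_add_charFun_neg (μ : Measure ℝ) [IsFiniteMeasure μ] (s : ℝ) :
    charFun μ s + charFun μ (-s) = 2 * ((∫ z, Real.cos (s * z) ∂μ : ℝ) : ℂ) := by
  rw [charFun_apply_real, charFun_apply_real,
    ← integral_add (integrable_exp_mul_I _ _) (integrable_exp_mul_I _ _),
    ← integral_complex_ofReal, ← integral_const_mul]
  congr 1
  ext z
  rw [Complex.ofReal_cos, Complex.two_cos]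
  push_cast
  ring_nf

theorem Complex.two_mul_I_mul_sin (w : ℂ) :
    2 * Complex.I * Complex.sin w = Complex.exp (w * Complex.I) - Complex.exp (-w * Complex.I) := by
  linear_combination Complex.I * Complex.two_sin w +
    (Complex.exp (-w * Complex.I) - Complex.exp (w * Complex.I)) * Complex.I_mul_I

theorem charFun_sub_charFun_neg (μ : Measure ℝ) [IsFiniteMeasure μ] (s : ℝ) :
    charFun μ s - charFun μ (-s) = 2 * Complex.I * ((∫ z, Real.sin (s * z) ∂μ : ℝ) : ℂ) := by
  rw [charFun_apply_real, charFun_apply_real,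
    ← integral_sub (integrable_exp_mul_I _ _) (integrable_exp_mul_I _ _),
    ← integral_complex_ofReal, ← integral_const_mul]
  congr 1
  ext z
  rw [Complex.ofReal_sin, Complex.two_mul_I_mul_sin]
  push_cast
  ring_nf

theorem sum_mul_integral_even_eq_zero (a : ι → ℝ) (μ : ι → Measure ℝ)
    [∀ k, IsFiniteMeasure (μ k)] (h : ∀ s, ∑ k, a k * ∫ z, Real.cos (s * z) ∂(μ k) = 0)
    {g : ℝ → ℝ} (hg : Measurable g) {C : ℝ} (hC : ∀ z, |g z| ≤ C) :
    ∑ k, a k * ∫ z, (g z + g (-z)) ∂(μ k) = 0 := by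
  have := sum_mul_integral_add_mul_neg_eq_zero 1 a μ (fun s => ?_) hg hC
  · simpa using this
  · have h2 := congrArg (fun y : ℝ => 2 * (y : ℂ)) (h s)
    simp only [Complex.ofReal_sum, Complex.ofReal_mul, Finset.mul_sum, Complex.ofReal_zero,
      mul_zero] at h2
    rw [← h2]
    refine Finset.sum_congr rfl fun k _ => ?_
    rw [Complex.ofReal_one, one_mul, charFun_add_charFun_neg]
    ring

theorem sum_mul_integral_odd_eq_zero (a : ι → ℝ) (μ : ι → Measure ℝ)
    [∀ k, IsFiniteMeasure (μ k)] (h : ∀ s, ∑ k, a k * ∫ z, Real.sin (s * z) ∂(μ k) = 0)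
    {g : ℝ → ℝ} (hg : Measurable g) {C : ℝ} (hC : ∀ z, |g z| ≤ C) :
    ∑ k, a k * ∫ z, (g z - g (-z)) ∂(μ k) = 0 := by
  have := sum_mul_integral_add_mul_neg_eq_zero (-1) a μ (fun s => ?_) hg hC
  · simpa [sub_eq_add_neg] using this
  · have h2 := congrArg (fun y : ℝ => 2 * Complex.I * (y : ℂ)) (h s)
    simp only [Complex.ofReal_sum, Complex.ofReal_mul, Finset.mul_sum, Complex.ofReal_zero,
      mul_zero] at h2
    rw [← h2]
    refine Finset.sum_congr rfl fun k _ => ?_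
    have := charFun_sub_charFun_neg (μ k) s
    push_cast
    rw [neg_one_mul, ← sub_eq_add_neg, this]
    ring

end WeightedFamilies

/-! ### Gaussian integrals of sines and cosines -/

section Gaussian

theorem integral_cos_gaussianReal (y : ℝ) (t : ℝ≥0) (s : ℝ) :
    ∫ z, Real.cos (s * z) ∂(gaussianReal y t) = Real.exp (-(s ^ 2 / 2) * t) * Real.cos (s * y) := by
  have h := charFun_add_charFun_neg (gaussianReal y t) s
  rw [charFun_gaussianReal, charFun_gaussianReal] at h
  have h2 := Complex.two_cos ((s * y : ℝ) : ℂ)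
  apply Complex.ofReal_injective
  apply mul_left_cancel₀ (two_ne_zero' ℂ)
  rw [← h]
  push_cast at h2 ⊢
  rw [mul_left_comm, h2, mul_add, ← Complex.exp_add, ← Complex.exp_add]
  ring_nf

theorem integral_sin_gaussianReal (y : ℝ) (t : ℝ≥0) (s : ℝ) :
    ∫ z, Real.sin (s * z) ∂(gaussianReal y t) = Real.exp (-(s ^ 2 / 2) * t) * Real.sin (s * y) := by
  have h := charFun_sub_charFun_neg (gaussianReal y t) s
  rw [charFun_gaussianReal, charFun_gaussianReal] at h
  have h2 := Complex.two_mul_I_mul_sin ((s * y : ℝ) : ℂ)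
  apply Complex.ofReal_injective
  apply mul_left_cancel₀ (mul_ne_zero (two_ne_zero' ℂ) Complex.I_ne_zero)
  rw [← h]
  push_cast at h2 ⊢
  rw [mul_left_comm, h2, mul_sub, ← Complex.exp_add, ← Complex.exp_add]
  ring_nf

theorem heat_neg (t : ℝ≥0) {g : ℝ → ℝ} (hg : Measurable g) (y : ℝ) :
    heat t g (-y) = ∫ z, g (-z) ∂(gaussianReal y t) := by
  rw [heat, ← gaussianReal_map_neg,
    integral_map measurable_neg.aemeasurable hg.aestronglyMeasurable]

end Gaussian

/-! ### A linear Volterra equation -/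

/-- The integral equation `y(t) = y₀ - c ∫₀ᵗ y` with bounded `y` has an exponential as its only
solution. No measurability is assumed. -/
theorem eq_exp_of_eq_sub_mul_integral {y : ℝ → ℝ} {y₀ c C : ℝ} (hC : ∀ t, |y t| ≤ C)
    (h : ∀ t, 0 ≤ t → y t = y₀ - c * ∫ u in (0 : ℝ)..t, y u) (t : ℝ) (ht : 0 ≤ t) :
    y t = y₀ * Real.exp (-c * t) := by
  have hint : IntervalIntegrable y volume 0 t := by
    by_contra hcon
    -- Measurability comes from the equation itself: `S`, the times up to which `y` is integrable,
    -- is an interval on which `y` is Lipschitz.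
    let S : Set ℝ := {s | 0 ≤ s ∧ IntervalIntegrable y volume 0 s}
    have hS : OrdConnected S := ⟨fun a ha b hb s hs => ⟨ha.1.trans hs.1, hb.2.mono_set (by
      rw [uIcc_of_le (ha.1.trans hs.1), uIcc_of_le hb.1]
      exact Icc_subset_Icc_right hs.2)⟩⟩
    have hc : ContinuousOn y S := by
      have : LipschitzOnWith (Real.toNNReal (|c| * C)) y S := by
        refine LipschitzOnWith.of_dist_le_mul fun a ha b hb => ?_
        rw [Real.dist_eq, Real.dist_eq, h a ha.1, h b hb.1, Real.coe_toNNReal _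
          (mul_nonneg (abs_nonneg _) ((abs_nonneg _).trans (hC 0)))]
        have e : y₀ - c * ∫ u in (0 : ℝ)..a, y u = y₀ - c * (∫ u in (0 : ℝ)..b, y u)
            - c * ∫ u in b..a, y u := by
          rw [← intervalIntegral.integral_add_adjacent_intervals hb.2 (hb.2.symm.trans ha.2)]
          ring
        rw [e, sub_sub_cancel_left, abs_neg, abs_mul, mul_assoc]
        gcongr
        exact intervalIntegral.norm_integral_le_of_norm_le_const (f := y) fun u _ => hC u
      exact this.continuousOn
    have hm : AEStronglyMeasurable y (volume.restrict (Ioc 0 t)) := by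
      have h1 : AEStronglyMeasurable y (volume.restrict S) :=
        hc.aestronglyMeasurable hS.measurableSet
      -- Off `S` the integral takes its default value `0`, so `y` is the constant `y₀` there.
      have h2 : AEStronglyMeasurable y (volume.restrict (Ioi 0 \ S)) := by
        refine (aestronglyMeasurable_const (b := y₀)).congr ?_
        refine (ae_restrict_iff' (measurableSet_Ioi.diff hS.measurableSet)).2
          (ae_of_all _ fun s hs => ?_)
        have h0 : (0 : ℝ) ≤ s := le_of_lt hs.1
        rw [h s h0, intervalIntegral.integral_undef fun h' => hs.2 ⟨h0, h'⟩]
        simp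
      refine (aestronglyMeasurable_union_iff.2 ⟨h1, h2⟩).mono_measure (Measure.restrict_mono (fun s hs => ?_) le_rfl)
      by_cases hsS : s ∈ S
      · exact Or.inl hsS
      · exact Or.inr ⟨hs.1, hsS⟩
    refine hcon ((intervalIntegrable_iff_integrableOn_Ioc_of_le ht).2 ?_)
    exact Integrable.of_bound hm C (ae_of_all _ hC)
  have hcont : ContinuousOn y (Icc 0 t) := by
    refine ContinuousOn.congr (f := fun s => y₀ - c * ∫ u in (0 : ℝ)..s, y u) ?_
      fun s hs => h s hs.1
    have := intervalIntegral.continuousOn_primitive_interval' hint left_mem_uIcc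
    rw [uIcc_of_le ht] at this
    exact continuousOn_const.sub (continuousOn_const.mul this)
  have hd : ∀ s ∈ Ico 0 t, HasDerivWithinAt y (-c * y s) (Ici s) s := by
    intro s hs
    have hw : ContinuousWithinAt y (Icc s t) s :=
      (hcont s ⟨hs.1, hs.2.le⟩).mono (Icc_subset_Icc_left hs.1)
    have h1 := intervalIntegral.integral_hasDerivWithinAt_right
      (hint.mono_set (c := 0) (d := s) (by
        rw [uIcc_of_le hs.1, uIcc_of_le ht]; exact Icc_subset_Icc_right hs.2.le))
      (s := Ici s) (t := Ioi s) ?_ ?_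
    · have h2 := (h1.const_mul c).const_sub y₀
      rw [← neg_mul] at h2
      exact h2.congr (fun r hr => h r (hs.1.trans hr)) (h s hs.1)
    · refine ⟨Ioc s t, Ioc_mem_nhdsGT hs.2, ?_⟩
      exact (hcont.mono fun r hr => ⟨hs.1.trans hr.1.le, hr.2⟩).aestronglyMeasurable
        measurableSet_Ioc
    · have : ContinuousWithinAt y (Ici s) s :=
        hw.mono_of_mem_nhdsWithin (Icc_mem_nhdsGE hs.2)
      exact this.mono Ioi_subset_Ici_self
  -- Integrating factor: `y s * exp (c s)` has zero right derivative.
  have hconst := constant_of_has_deriv_right_zero (f := fun s => y s * Real.exp (c * s))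
    (hcont.mul (by fun_prop)) (fun s hs => by
      have he : HasDerivAt (fun s => Real.exp (c * s)) (Real.exp (c * s) * (c * 1)) s :=
        ((hasDerivAt_id s).const_mul c).exp
      refine ((hd s hs).mul he.hasDerivWithinAt).congr_deriv ?_
      ring) t ⟨ht, le_rfl⟩
  have h0 : y 0 = y₀ := by simpa using h 0 le_rfl
  simp only [mul_zero, Real.exp_zero, mul_one, h0] at hconst
  rw [← hconst, mul_assoc, ← Real.exp_add]
  simp

/-! ### Coordinates on the graph -/

namespace StarGraph

variable {N : ℕ}

/-- The `i`-th coordinate of a point of the graph: `h` at `h eᵢ`, and `0` off the `i`-th ray. -/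
def coord (i : Fin N) (x : StarGraph N) : ℝ := x.1 i

theorem continuous_coord (i : Fin N) : Continuous (coord i) := by
  unfold coord; fun_prop

theorem coord_ray (i j : Fin N) (h : ℝ≥0) : coord i (ray j h) = if i = j then (h : ℝ) else 0 := by
  simp [coord, ray]

theorem exists_eq_ray (x : StarGraph N) : ∃ i h, x = ray i h := by
  obtain ⟨x, i, h, rfl⟩ := x
  exact ⟨i, h, rfl⟩

theorem coord_nonneg (i : Fin N) (x : StarGraph N) : 0 ≤ coord i x := by
  obtain ⟨j, h, rfl⟩ := exists_eq_ray x
  rw [coord_ray]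
  split_ifs <;> simp

/-- At most one coordinate of a point is nonzero, so functions given ray by ray and vanishing at `0`
can be glued by summation. -/
theorem sum_coord_ray {φ : Fin N → ℝ → ℝ} (hφ : ∀ i, φ i 0 = 0) (j : Fin N) (h : ℝ≥0) :
    ∑ i, φ i (coord i (ray j h)) = φ j h := by
  rw [Finset.sum_eq_single j]
  · simp [coord_ray]
  · intro i _ hi
    simp [coord_ray, hi, hφ]
  · simp

variable [NeZero N]

theorem ray_zero (i : Fin N) : ray i 0 = origin := by
  simp [origin, ray]

theorem radius_ray (i : Fin N) (h : ℝ≥0) : radius (ray i h) = h := by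
  rw [radius, ← ray_zero i, dist_ray]
  simp

theorem radius_nonneg (x : StarGraph N) : 0 ≤ radius x := dist_nonneg

theorem radius_pos {x : StarGraph N} (hx : x ≠ origin) : 0 < radius x := dist_pos.2 hx

theorem ray_rayIndex {x : StarGraph N} (hx : x ≠ origin) :
    ray (rayIndex x) (radius x).toNNReal = x := by
  rw [rayIndex, if_neg hx]
  obtain ⟨h, hh⟩ := x.2.choose_spec
  have hx' : x = ray x.2.choose h := Subtype.ext hh
  conv_lhs => rw [hx', radius_ray, ← hx']
  rw [Real.toNNReal_coe]
  exact hx'.symm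

theorem radius_origin : radius (origin : StarGraph N) = 0 := dist_self _

theorem ray_rayIndex' (x : StarGraph N) : ray (rayIndex x) (radius x).toNNReal = x := by
  by_cases hx : x = origin
  · rw [hx, radius_origin, Real.toNNReal_zero, ray_zero]
  · exact ray_rayIndex hx

theorem coord_eq_ite (i : Fin N) (x : StarGraph N) :
    coord i x = if i = rayIndex x then radius x else 0 := by
  conv_lhs => rw [← ray_rayIndex' x]
  rw [coord_ray, Real.coe_toNNReal _ (radius_nonneg x)]

end StarGraph

open StarGraph

/-! ### Decomposition of functions along the coordinates -/

section Functions

variable {N : ℕ}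

theorem onRay_coe (f : StarGraph N → ℝ) (j : Fin N) (h : ℝ≥0) :
    onRay f j h = f (ray j h) := by
  simp [onRay]

theorem eq_add_sum_onRay [NeZero N] (f : StarGraph N → ℝ) (x : StarGraph N) :
    f x = f origin + ∑ i, (onRay f i (coord i x) - f origin) := by
  obtain ⟨j, h, rfl⟩ := exists_eq_ray x
  have h0 : ∀ i, onRay f i 0 = f origin := fun i => by
    simpa [ray_zero] using onRay_coe f i 0
  rw [sum_coord_ray (φ := fun i z => onRay f i z - f origin) (fun i => by simp [h0]),
    onRay_coe]
  ring

theorem measurable_onRay {f : StarGraph N → ℝ} (hf : Continuous f) (i : Fin N) :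
    Measurable (onRay f i) := by
  unfold onRay
  refine Measurable.ite measurableSet_Ici (hf.comp ?_).measurable measurable_const
  refine Continuous.subtype_mk ?_ _
  refine (PiLp.continuous_toLp 1 _).comp ?_
  exact (continuous_single i).comp (NNReal.continuous_coe.comp continuous_real_toNNReal)

end Functions

/-! ### Trigonometric eigenfunctions of the second derivative -/

/-- The function on the graph equal to `Aᵢ sin (s h) + B cos (s h)` on the `i`-th ray. -/
noncomputable def trigFun {N : ℕ} (A : Fin N → ℝ) (B s : ℝ) (x : StarGraph N) : ℝ :=
  B + ∑ i, (A i * Real.sin (s * coord i x) + B * (Real.cos (s * coord i x) - 1))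

section Trig

variable {N : ℕ} (A : Fin N → ℝ) (B s : ℝ)

theorem continuous_trigFun : Continuous (trigFun A B s) := by
  have := continuous_coord (N := N)
  unfold trigFun
  fun_prop

/-- Using `cos - 1` in the sum makes the terms of the other rays vanish; the constant `B` restores
the cosine. -/
theorem trigFun_ray (j : Fin N) (h : ℝ≥0) :
    trigFun A B s (ray j h) = A j * Real.sin (s * h) + B * Real.cos (s * h) := by
  rw [trigFun, sum_coord_ray
    (φ := fun i z => A i * Real.sin (s * z) + B * (Real.cos (s * z) - 1)) (fun i => by simp)]
  ring

theorem onRay_trigFun {h : ℝ} (hh : 0 < h) (j : Fin N) :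
    onRay (trigFun A B s) j h = A j * Real.sin (s * h) + B * Real.cos (s * h) := by
  lift h to ℝ≥0 using hh.le
  rw [onRay_coe, trigFun_ray]

theorem deriv_onRay_trigFun {h : ℝ} (hh : 0 < h) (j : Fin N) :
    HasDerivAt (onRay (trigFun A B s) j)
      (s * (A j * Real.cos (s * h) - B * Real.sin (s * h))) h := by
  have h1 : HasDerivAt (fun z : ℝ => s * z) s h := by simpa using (hasDerivAt_id h).const_mul s
  have := (h1.sin.const_mul (A j)).add (h1.cos.const_mul B)
  refine (this.congr_deriv (by ring)).congr_of_eventuallyEq ?_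
  filter_upwards [Ioi_mem_nhds hh] with z hz using onRay_trigFun A B s hz j

theorem deriv2_onRay_trigFun {h : ℝ} (hh : 0 < h) (j : Fin N) :
    HasDerivAt (deriv (onRay (trigFun A B s) j))
      (-s ^ 2 * (A j * Real.sin (s * h) + B * Real.cos (s * h))) h := by
  have h1 : HasDerivAt (fun z : ℝ => s * z) s h := by simpa using (hasDerivAt_id h).const_mul s
  have := ((h1.cos.const_mul (A j)).sub (h1.sin.const_mul B)).const_mul s
  refine (this.congr_deriv (by ring)).congr_of_eventuallyEq ?_
  filter_upwards [Ioi_mem_nhds hh] with z hz using (deriv_onRay_trigFun A B s hz j).deriv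

theorem tendsto_deriv_onRay_trigFun (j : Fin N) :
    Tendsto (deriv (onRay (trigFun A B s) j)) (𝓝[>] 0) (𝓝 (s * A j)) := by
  have : Continuous fun h : ℝ => s * (A j * Real.cos (s * h) - B * Real.sin (s * h)) := by
    fun_prop
  have h2 := (this.tendsto 0).mono_left (nhdsWithin_le_nhds (s := Ioi 0))
  simp only [mul_zero, Real.cos_zero, Real.sin_zero, mul_one, sub_zero] at h2
  refine h2.congr' ?_
  filter_upwards [self_mem_nhdsWithin] with z hz using (deriv_onRay_trigFun A B s hz j).deriv.symm

theorem tendsto_deriv2_onRay_trigFun (j : Fin N) :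
    Tendsto (deriv (deriv (onRay (trigFun A B s) j))) (𝓝[>] 0) (𝓝 (-s ^ 2 * B)) := by
  have : Continuous fun h : ℝ => -s ^ 2 * (A j * Real.sin (s * h) + B * Real.cos (s * h)) := by
    fun_prop
  have h2 := (this.tendsto 0).mono_left (nhdsWithin_le_nhds (s := Ioi 0))
  simp only [mul_zero, Real.cos_zero, Real.sin_zero, mul_one, zero_add] at h2
  refine h2.congr' ?_
  filter_upwards [self_mem_nhdsWithin] with z hz using (deriv2_onRay_trigFun A B s hz j).deriv.symm

theorem abs_mul_sin_add_mul_cos_le (a b z : ℝ) :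
    |a * Real.sin z + b * Real.cos z| ≤ |a| + |b| := by
  refine (abs_add_le _ _).trans (add_le_add ?_ ?_) <;> rw [abs_mul]
  · exact mul_le_of_le_one_right (abs_nonneg _) (Real.abs_sin_le_one _)
  · exact mul_le_of_le_one_right (abs_nonneg _) (Real.abs_cos_le_one _)

theorem isCb2_trigFun : IsCb2 (trigFun A B s) where
  continuous := continuous_trigFun A B s
  diff i h hh := (deriv_onRay_trigFun A B s hh i).differentiableAt.differentiableWithinAt
  diff' i h hh := (deriv2_onRay_trigFun A B s hh i).differentiableAt.differentiableWithinAt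
  continuousOn_deriv i h hh :=
    (deriv2_onRay_trigFun A B s hh i).continuousAt.continuousWithinAt
  continuousOn_deriv2 i := by
    refine ContinuousOn.congr
      (f := fun h : ℝ => -s ^ 2 * (A i * Real.sin (s * h) + B * Real.cos (s * h)))
      (by fun_prop) fun h hh => (deriv2_onRay_trigFun A B s hh i).deriv
  bounded_deriv i := by
    refine ⟨|s| * (|B| + |A i|), fun h hh => ?_⟩
    rw [(deriv_onRay_trigFun A B s hh i).deriv, abs_mul]
    gcongr
    have := abs_mul_sin_add_mul_cos_le (-B) (A i) (s * h)
    rw [abs_neg] at this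
    rwa [neg_mul, neg_add_eq_sub] at this
  bounded_deriv2 i := by
    refine ⟨|-s ^ 2| * (|A i| + |B|), fun h hh => ?_⟩
    rw [(deriv2_onRay_trigFun A B s hh i).deriv, abs_mul]
    gcongr
    exact abs_mul_sin_add_mul_cos_le _ _ _
  tendsto_deriv i := ⟨_, tendsto_deriv_onRay_trigFun A B s i⟩
  tendsto_deriv2 i := ⟨_, tendsto_deriv2_onRay_trigFun A B s i⟩

/-- Cosines have zero slope at the origin, so only the sine coefficients enter the gluing condition.
-/
theorem trigFun_mem_walshDomain {α : Fin N → ℝ} (hA : ∑ i, α i * A i = 0) :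
    trigFun A B s ∈ walshDomain α := by
  refine ⟨isCb2_trigFun A B s, ?_⟩
  have : ∀ i, derivZero (trigFun A B s) i = s * A i := fun i =>
    (tendsto_deriv_onRay_trigFun A B s i).limUnder_eq
  simp_rw [this, mul_left_comm _ s, ← Finset.mul_sum, hA, mul_zero]

/-- The convention at the origin is harmless: the limit `-s ^ 2 * B` is the same on every ray. -/
theorem secondDeriv_trigFun [NeZero N] (x : StarGraph N) :
    secondDeriv (trigFun A B s) x = -s ^ 2 * trigFun A B s x := by
  rw [secondDeriv]
  split_ifs with hx
  · rw [hx, ← ray_zero ⊤, trigFun_ray, deriv2Zero,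
      (tendsto_deriv2_onRay_trigFun A B s ⊤).limUnder_eq]
    simp
  · rw [(deriv2_onRay_trigFun A B s (radius_pos hx) _).deriv]
    conv_rhs => rw [← ray_rayIndex hx]
    rw [trigFun_ray, Real.coe_toNNReal _ (radius_nonneg x)]

theorem abs_trigFun_le (x : StarGraph N) : |trigFun A B s x| ≤ ∑ i, |A i| + |B| := by
  obtain ⟨j, h, rfl⟩ := exists_eq_ray x
  rw [trigFun_ray]
  refine (abs_mul_sin_add_mul_cos_le _ _ _).trans (add_le_add_left ?_ _)
  exact Finset.single_le_sum (f := fun i => |A i|) (fun i _ => abs_nonneg _) (Finset.mem_univ j)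

end Trig

/-! ### Transition measures -/

theorem abs_sub_clamp_le {ε : ℝ} (hε : 0 ≤ ε) (a : ℝ) :
    |a - (a - max (-ε) (min a ε))| ≤ ε := by
  rw [sub_sub_cancel, abs_le]
  exact ⟨le_max_left _ _, max_le (by linarith) (min_le_right _ _)⟩

/-- Soft thresholding turns functions vanishing at infinity into compactly supported ones. -/
theorem ZeroAtInftyContinuousMap.exists_compactlySupported_near {E : Type*} [TopologicalSpace E]
    [R1Space E] (f : C₀(E, ℝ)) {ε : ℝ} (hε : 0 < ε) :
    ∃ g : C_c(E, ℝ), ∀ x, |f x - g x| ≤ ε := by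
  refine ⟨⟨⟨fun x => f x - max (-ε) (min (f x) ε), by fun_prop⟩, ?_⟩, fun x =>
    abs_sub_clamp_le hε.le _⟩
  have h : {x | |f x| < ε} ∈ cocompact E := by
    have : ∀ᶠ x in cocompact E, f x ∈ Metric.ball (0 : ℝ) ε :=
      (zero_at_infty f).eventually (Metric.ball_mem_nhds (0 : ℝ) hε)
    simp only [Metric.mem_ball, Real.dist_eq, sub_zero] at this
    exact this
  obtain ⟨K, hK, hKs⟩ := mem_cocompact.1 h
  refine HasCompactSupport.intro hK fun x hx => ?_
  have : |f x| < ε := hKs hx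
  rw [abs_lt] at this
  simp [min_eq_left this.2.le, max_eq_right this.1.le]

namespace FellerSemigroup

variable {E : Type*} [TopologicalSpace E] [T2Space E] [LocallyCompactSpace E] [MeasurableSpace E]
  [BorelSpace E]

theorem integrable_transition (Q : FellerSemigroup E) (t : ℝ≥0) (x : E)
    [IsFiniteMeasure (Q.transition t x)] (f : C₀(E, ℝ)) : Integrable f (Q.transition t x) :=
  Integrable.of_bound f.continuous.aestronglyMeasurable ‖f‖
    (ae_of_all _ fun y => (f.toBCF).norm_coe_le_norm y)

/-- The Riesz measure represents `Q` on `C_c` only; density extends this to `C₀`, both sides being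
contractions for the sup norm. -/
theorem integral_transition (Q : FellerSemigroup E) (t : ℝ≥0) (x : E)
    [IsProbabilityMeasure (Q.transition t x)] (f : C₀(E, ℝ)) :
    ∫ y, f y ∂(Q.transition t x) = Q.op t f x := by
  refine eq_of_forall_dist_le fun ε hε => ?_
  obtain ⟨g, hg⟩ := f.exists_compactlySupported_near (half_pos hε)
  have h1 : ∫ y, g y ∂(Q.transition t x) = Q.op t (g : C₀(E, ℝ)) x :=
    RealRMK.integral_rieszMeasure _ g
  have h2 : |∫ y, f y ∂(Q.transition t x) - ∫ y, g y ∂(Q.transition t x)| ≤ ε / 2 := by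
    have hgi : Integrable g (Q.transition t x) := Q.integrable_transition t x (g : C₀(E, ℝ))
    rw [← integral_sub (Q.integrable_transition t x f) hgi]
    simpa using norm_integral_le_of_norm_le_const (μ := Q.transition t x)
      (f := fun y => f y - g y) (ae_of_all _ hg)
  have h3 : |Q.op t (g : C₀(E, ℝ)) x - Q.op t f x| ≤ ε / 2 := by
    have h4 : ‖(g : C₀(E, ℝ)) - f‖ ≤ ε / 2 := by
      refine (BoundedContinuousFunction.norm_le (half_pos hε).le).2 fun y => ?_
      change |g y - f y| ≤ ε / 2
      rw [abs_sub_comm]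
      exact hg y
    have h5 := (Q.op t ((g : C₀(E, ℝ)) - f)).toBCF.norm_coe_le_norm x
    rw [map_sub] at h5
    refine le_trans h5 (le_trans ?_ h4)
    have := Q.contraction t ((g : C₀(E, ℝ)) - f)
    rwa [map_sub] at this
  rw [h1] at h2
  rw [Real.dist_eq]
  calc _ ≤ _ := abs_sub_le _ (Q.op t (g : C₀(E, ℝ)) x) _
    _ ≤ ε := by linarith

end FellerSemigroup

/-! ### Identification of a measure on the graph from its trigonometric integrals -/

section Comparison

variable {ι : Type*} [Fintype ι]

/-- The difference is a single combination over the joint family `μ, ν` with coefficients `a, -a`.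
-/
theorem sum_mul_integral_even_sub_eq_zero (a : ι → ℝ) (μ ν : ι → Measure ℝ)
    [∀ k, IsFiniteMeasure (μ k)] [∀ k, IsFiniteMeasure (ν k)]
    (h : ∀ s, ∑ k, a k * (∫ z, Real.cos (s * z) ∂(μ k) - ∫ z, Real.cos (s * z) ∂(ν k)) = 0)
    {g : ℝ → ℝ} (hg : Measurable g) {C : ℝ} (hC : ∀ z, |g z| ≤ C) :
    ∑ k, a k * (∫ z, (g z + g (-z)) ∂(μ k) - ∫ z, (g z + g (-z)) ∂(ν k)) = 0 := by
  have : ∀ k, IsFiniteMeasure (Sum.elim μ ν k) := Sum.rec (by simpa) (by simpa)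
  have := sum_mul_integral_even_eq_zero (Sum.elim a (-a)) (Sum.elim μ ν) (fun s => ?_) hg hC
  · simpa only [Fintype.sum_sum_type, Sum.elim_inl, Sum.elim_inr, Pi.neg_apply, neg_mul,
      Finset.sum_neg_distrib, ← sub_eq_add_neg, ← Finset.sum_sub_distrib, ← mul_sub] using this
  · simpa only [Fintype.sum_sum_type, Sum.elim_inl, Sum.elim_inr, Pi.neg_apply, neg_mul,
      Finset.sum_neg_distrib, ← sub_eq_add_neg, ← Finset.sum_sub_distrib, ← mul_sub] using h s

theorem sum_mul_integral_odd_sub_eq_zero (a : ι → ℝ) (μ ν : ι → Measure ℝ)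
    [∀ k, IsFiniteMeasure (μ k)] [∀ k, IsFiniteMeasure (ν k)]
    (h : ∀ s, ∑ k, a k * (∫ z, Real.sin (s * z) ∂(μ k) - ∫ z, Real.sin (s * z) ∂(ν k)) = 0)
    {g : ℝ → ℝ} (hg : Measurable g) {C : ℝ} (hC : ∀ z, |g z| ≤ C) :
    ∑ k, a k * (∫ z, (g z - g (-z)) ∂(μ k) - ∫ z, (g z - g (-z)) ∂(ν k)) = 0 := by
  have : ∀ k, IsFiniteMeasure (Sum.elim μ ν k) := Sum.rec (by simpa) (by simpa)
  have := sum_mul_integral_odd_eq_zero (Sum.elim a (-a)) (Sum.elim μ ν) (fun s => ?_) hg hC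
  · simpa only [Fintype.sum_sum_type, Sum.elim_inl, Sum.elim_inr, Pi.neg_apply, neg_mul,
      Finset.sum_neg_distrib, ← sub_eq_add_neg, ← Finset.sum_sub_distrib, ← mul_sub] using this
  · simpa only [Fintype.sum_sum_type, Sum.elim_inl, Sum.elim_inr, Pi.neg_apply, neg_mul,
      Finset.sum_neg_distrib, ← sub_eq_add_neg, ← Finset.sum_sub_distrib, ← mul_sub] using h s

end Comparison

namespace StarGraph

variable {N : ℕ}

theorem integral_comp_coord (μ : Measure (StarGraph N)) {g : ℝ → ℝ} (hg : Measurable g)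
    (i : Fin N) : ∫ z, g z ∂(μ.map (coord i)) = ∫ y, g (coord i y) ∂μ :=
  integral_map (continuous_coord i).measurable.aemeasurable hg.aestronglyMeasurable

theorem integrable_comp_coord (μ : Measure (StarGraph N)) [IsFiniteMeasure μ] {g : ℝ → ℝ}
    (hg : Measurable g) {C : ℝ} (hC : ∀ z, |g z| ≤ C) (i : Fin N) :
    Integrable (fun y => g (coord i y)) μ :=
  Integrable.of_bound (hg.comp (continuous_coord i).measurable).aestronglyMeasurable C
    (ae_of_all _ fun _ => hC _)

theorem isProbabilityMeasure_map_coord (μ : Measure (StarGraph N)) [IsProbabilityMeasure μ]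
    (i : Fin N) : IsProbabilityMeasure (μ.map (coord i)) :=
  Measure.isProbabilityMeasure_map (continuous_coord i).measurable.aemeasurable

end StarGraph

/-- `μ` integrates the trigonometric functions in `D(α)` as the Walsh Brownian motion started at
`x` does at time `t`. -/
def HasWalshTransform {N : ℕ} (α : Fin N → ℝ) (t : ℝ≥0) (x : StarGraph N)
    (μ : Measure (StarGraph N)) : Prop :=
  ∀ (A : Fin N → ℝ) (B s : ℝ), ∑ i, α i * A i = 0 →
    ∫ y, trigFun A B s y ∂μ = Real.exp (-(s ^ 2 / 2) * t) * trigFun A B s x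

namespace HasWalshTransform

variable {N : ℕ} [NeZero N] {α : Fin N → ℝ} {t : ℝ≥0} {x : StarGraph N}
  {μ : Measure (StarGraph N)} [IsProbabilityMeasure μ]

/-- The radial part of `μ` is that of a reflected Gaussian. -/
theorem sum_integral_coord (h : HasWalshTransform α t x μ) {g : ℝ → ℝ} (hg : Measurable g)
    {C : ℝ} (hC : ∀ z, |g z| ≤ C) (h0 : ∀ z ≤ 0, g z = 0) :
    ∑ i, ∫ y, g (coord i y) ∂μ = heat t g (radius x) + heat t g (-radius x) := by
  classical
  have hm := isProbabilityMeasure_map_coord μ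
  -- The Dirac masses account for the `N - 1` constants left by the terms `cos - 1`, and do not
  -- charge `g` since `g 0 = 0`.
  let ν : Fin N → Measure ℝ := fun j =>
    if j = rayIndex x then gaussianReal (radius x) t else Measure.dirac 0
  have hν : ∀ j, IsFiniteMeasure (ν j) := fun j => by
    simp only [ν]; split_ifs <;> infer_instance
  have hνi : ∀ (φ : ℝ → ℝ) (j : Fin N), ∫ z, φ z ∂(ν j) =
      φ 0 + if j = rayIndex x then ∫ z, φ z ∂(gaussianReal (radius x) t) - φ 0 else 0 := by
    intro φ j
    simp only [ν]
    split_ifs <;> simp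
  have key := sum_mul_integral_even_sub_eq_zero (fun _ => 1) (fun i => μ.map (coord i)) ν
    (fun s => ?_) hg hC
  · simp only [one_mul, Finset.sum_sub_distrib, sub_eq_zero, hνi] at key
    have hE : Measurable fun z => g z + g (-z) := hg.add (hg.comp measurable_neg)
    have e : ∀ i, ∫ z, (g z + g (-z)) ∂(μ.map (coord i)) = ∫ y, g (coord i y) ∂μ := fun i => by
      rw [integral_comp_coord μ hE]
      refine integral_congr_ae (ae_of_all _ fun y => ?_)
      simp [h0 _ (neg_nonpos.2 (coord_nonneg i y))]
    simp only [e, neg_zero, h0 0 le_rfl, add_zero, zero_add, sub_zero, Finset.sum_ite_eq',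
      Finset.mem_univ, if_true] at key
    rw [key, heat_neg t hg, heat, integral_add]
    · exact Integrable.of_bound hg.aestronglyMeasurable C (ae_of_all _ hC)
    · exact Integrable.of_bound (hg.comp measurable_neg).aestronglyMeasurable C
        (ae_of_all _ fun z => hC _)
  · have h1 := h 0 1 s (by simp)
    have hcos : Measurable fun z => Real.cos (s * z) := by fun_prop
    have hi : ∀ i, Integrable (fun y => Real.cos (s * coord i y)) μ := fun i =>
      integrable_comp_coord μ hcos (fun z => Real.abs_cos_le_one _) i
    have hx : trigFun 0 1 s x = Real.cos (s * radius x) := by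
      conv_lhs => rw [← ray_rayIndex' x]
      rw [trigFun_ray, Real.coe_toNNReal _ (radius_nonneg x)]
      simp
    rw [hx] at h1
    simp only [trigFun, Pi.zero_apply, zero_mul, zero_add, one_mul] at h1
    have hi1 : ∀ i, Integrable (fun y => Real.cos (s * coord i y) - 1) μ := fun i =>
      (hi i).sub (integrable_const _)
    rw [integral_add (integrable_const _) (integrable_finsetSum _ fun i _ => hi1 i),
      integral_finsetSum _ fun i _ => hi1 i] at h1
    simp only [integral_sub (hi _) (integrable_const _)] at h1
    simp only [one_mul, Finset.sum_sub_distrib, hνi, integral_comp_coord μ hcos,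
      integral_cos_gaussianReal, ← h1]
    simp [Finset.sum_add_distrib]

theorem integral_coord_sub (h : HasWalshTransform α t x μ) (hα1 : ∑ i, α i = 1) {g : ℝ → ℝ}
    (hg : Measurable g) {C : ℝ} (hC : ∀ z, |g z| ≤ C) (h0 : ∀ z ≤ 0, g z = 0) (i : Fin N) :
    ∫ y, g (coord i y) ∂μ - α i * ∑ j, ∫ y, g (coord j y) ∂μ =
      ((if i = rayIndex x then 1 else 0) - α i) *
        (heat t g (radius x) - heat t g (-radius x)) := by
  classical
  have hm := isProbabilityMeasure_map_coord μ
  -- Admissible sine coefficients: `∑ⱼ αⱼ aⱼ = αᵢ - αᵢ ∑ⱼ αⱼ = 0`.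
  let a : Fin N → ℝ := fun j => (if j = i then 1 else 0) - α i
  have ha : ∀ φ : Fin N → ℝ, ∑ j, a j * φ j = φ i - α i * ∑ j, φ j := fun φ => by
    simp [a, sub_mul, Finset.sum_sub_distrib, Finset.mul_sum]
  -- On rays not containing `x` the reference Gaussian is centred, so odd functions integrate to
  -- zero against it.
  have key := sum_mul_integral_odd_sub_eq_zero a (fun j => μ.map (coord j))
    (fun j => gaussianReal (coord j x) t) (fun s => ?_) hg hC
  · simp only [mul_sub, Finset.sum_sub_distrib, sub_eq_zero] at key
    have hO : Measurable fun z => g z - g (-z) := hg.sub (hg.comp measurable_neg)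
    have e : ∀ i, ∫ z, (g z - g (-z)) ∂(μ.map (coord i)) = ∫ y, g (coord i y) ∂μ := fun i => by
      rw [integral_comp_coord μ hO]
      refine integral_congr_ae (ae_of_all _ fun y => ?_)
      simp [h0 _ (neg_nonpos.2 (coord_nonneg i y))]
    have e2 : ∀ j, ∫ z, (g z - g (-z)) ∂(gaussianReal (coord j x) t) =
        if j = rayIndex x then heat t g (radius x) - heat t g (-radius x) else 0 := fun j => by
      rw [integral_sub, ← heat_neg t hg, ← heat, coord_eq_ite]
      · split_ifs <;> simp
      · exact Integrable.of_bound hg.aestronglyMeasurable C (ae_of_all _ hC)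
      · exact Integrable.of_bound (hg.comp measurable_neg).aestronglyMeasurable C
          (ae_of_all _ fun z => hC _)
    simp only [e, e2] at key
    rw [ha, ha] at key
    rw [key, Finset.sum_ite_eq', if_pos (Finset.mem_univ _), sub_mul, ite_mul, one_mul, zero_mul]
  · have hA : ∑ j, α j * a j = 0 := by
      simp_rw [mul_comm (α _)]
      rw [ha, hα1, mul_one, sub_self]
    have h1 := h a 0 s hA
    have hsin : Measurable fun z => Real.sin (s * z) := by fun_prop
    have hi : ∀ i, Integrable (fun y => Real.sin (s * coord i y)) μ := fun i =>
      integrable_comp_coord μ hsin (fun z => Real.abs_sin_le_one _) i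
    simp only [trigFun, zero_mul, add_zero, zero_add] at h1
    rw [integral_finsetSum _ fun i _ => (hi i).const_mul _] at h1
    simp only [integral_const_mul] at h1
    simp only [mul_sub, Finset.sum_sub_distrib, integral_comp_coord μ hsin,
      integral_sin_gaussianReal, h1, Finset.mul_sum, mul_left_comm, sub_self]

theorem integral_coord (h : HasWalshTransform α t x μ) (hα1 : ∑ i, α i = 1) {g : ℝ → ℝ}
    (hg : Measurable g) {C : ℝ} (hC : ∀ z, |g z| ≤ C) (h0 : ∀ z ≤ 0, g z = 0) (i : Fin N) :
    ∫ y, g (coord i y) ∂μ = 2 * (α i * heat t g (-radius x)) +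
      if i = rayIndex x then heat t g (radius x) - heat t g (-radius x) else 0 := by
  have h1 := h.integral_coord_sub hα1 hg hC h0 i
  rw [h.sum_integral_coord hg hC h0] at h1
  split_ifs at h1 ⊢ <;> linarith

end HasWalshTransform

/-- At radius `0` the last two terms cancel, so the origin needs no separate formula. -/
theorem walshSemigroup_of_ne_zero {N : ℕ} [NeZero N] (α : Fin N → ℝ) {t : ℝ≥0} (ht : t ≠ 0)
    (f : StarGraph N → ℝ) (x : StarGraph N) :
    walshSemigroup α t f x = 2 * ∑ i, α i * heat t (onRay f i) (-radius x)
      + heat t (onRay f (rayIndex x)) (radius x) - heat t (onRay f (rayIndex x)) (-radius x) := by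
  rw [walshSemigroup, if_neg ht]
  split_ifs with hx
  · simp [hx, radius_origin]
  · rfl

theorem HasWalshTransform.integral_eq {N : ℕ} [NeZero N] {α : Fin N → ℝ} {t : ℝ≥0}
    {x : StarGraph N} {μ : Measure (StarGraph N)} [IsProbabilityMeasure μ]
    (h : HasWalshTransform α t x μ) (hα1 : ∑ i, α i = 1) (ht : t ≠ 0)
    {f : StarGraph N → ℝ} (hf : Continuous f) {C : ℝ} (hC : ∀ y, |f y| ≤ C) :
    ∫ y, f y ∂μ = walshSemigroup α t f x := by
  classical
  set b := f origin with hb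
  -- `onRay f i` jumps from `0` to `f origin` at `0`; subtracting `b * u` makes it vanish on all of
  -- `(-∞, 0]`.
  let u : ℝ → ℝ := (Ici 0).indicator 1
  have hu : Measurable u := measurable_one.indicator measurableSet_Ici
  have hui : ∀ y, Integrable u (gaussianReal y t) := fun y =>
    (integrable_const (1 : ℝ)).indicator measurableSet_Ici
  have hfm := measurable_onRay hf
  have hfC : ∀ i z, |onRay f i z| ≤ C := fun i z => by
    rw [onRay]
    split_ifs
    · exact hC _
    · simpa using (abs_nonneg _).trans (hC origin)
  have hfi : ∀ i y, Integrable (onRay f i) (gaussianReal y t) := fun i y =>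
    Integrable.of_bound (hfm i).aestronglyMeasurable C (ae_of_all _ (hfC i))
  let g : Fin N → ℝ → ℝ := fun i z => onRay f i z - b * u z
  have hg : ∀ i, Measurable (g i) := fun i => (hfm i).sub (hu.const_mul b)
  have hu1 : ∀ z, |u z| ≤ 1 := fun z => by
    simp only [u, indicator_apply]; split_ifs <;> simp
  have hgC : ∀ i z, |g i z| ≤ C + |b| := fun i z => by
    refine (abs_sub _ _).trans (add_le_add (hfC i z) ?_)
    rw [abs_mul]
    exact mul_le_of_le_one_right (abs_nonneg _) (hu1 z)
  have hg0 : ∀ i, ∀ z ≤ 0, g i z = 0 := fun i z hz => by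
    rcases hz.lt_or_eq with hz | rfl
    · simp [g, u, onRay, hz.not_ge]
    · simp [g, u, onRay, ray_zero, hb]
  have hheat : ∀ i y, heat t (g i) y = heat t (onRay f i) y - b * heat t u y := fun i y => by
    simp only [heat, g]
    rw [integral_sub (hfi i y) ((hui y).const_mul b), integral_const_mul]
  -- `u z + u (-z) = 1` except at `z = 0`, which is null because `t ≠ 0`.
  have hu2 : heat t u (radius x) + heat t u (-radius x) = 1 := by
    have := nullSingletonClass_gaussianReal (μ := radius x) ht
    have hui' : Integrable (fun z => u (-z)) (gaussianReal (radius x) t) :=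
      Integrable.of_bound (hu.comp measurable_neg).aestronglyMeasurable 1
        (ae_of_all _ fun z => hu1 _)
    rw [heat_neg t hu, heat, ← integral_add (hui _) hui']
    have : (fun z => u z + u (-z)) =ᵐ[gaussianReal (radius x) t] fun _ => (1 : ℝ) := by
      filter_upwards [Measure.ae_ne (gaussianReal (radius x) t) 0] with z hz
      rcases hz.lt_or_gt with hz | hz
      · simp [u, hz.le, hz.not_ge]
      · simp [u, hz.le, hz.not_ge]
    rw [integral_congr_ae this]
    simp
  have hdec : ∀ y, f y = b + ∑ i, g i (coord i y) := fun y => by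
    conv_lhs => rw [eq_add_sum_onRay f y]
    simp [g, u, coord_nonneg, hb]
  have hgi : ∀ i, Integrable (fun y => g i (coord i y)) μ := fun i =>
    integrable_comp_coord μ (hg i) (hgC i) i
  calc ∫ y, f y ∂μ = b + ∑ i, ∫ y, g i (coord i y) ∂μ := by
        simp_rw [hdec]
        rw [integral_add (integrable_const _) (integrable_finsetSum _ fun i _ => hgi i),
          integral_finsetSum _ fun i _ => hgi i]
        simp
    _ = _ := by
        have hsum : ∑ i, α i * (b * heat t u (-radius x)) = b * heat t u (-radius x) := by
          rw [← Finset.sum_mul, hα1, one_mul]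
        simp_rw [h.integral_coord hα1 (hg _) (hgC _) (hg0 _), hheat]
        rw [walshSemigroup_of_ne_zero α ht, Finset.sum_add_distrib, Finset.sum_ite_eq',
          if_pos (Finset.mem_univ _), ← Finset.mul_sum]
        simp_rw [mul_sub, Finset.sum_sub_distrib, hsum]
        linear_combination -b * hu2

/-! ### The main theorem -/

theorem mainTheorem4 (N : ℕ) [NeZero N] (α : Fin N → ℝ) (hα : ∀ i, 0 < α i)
    (hα1 : ∑ i, α i = 1) (Q : FellerSemigroup (StarGraph N))
    (hQ : ∀ f ∈ walshDomain α, ∀ (t : ℝ≥0) (x : StarGraph N),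
      Integrable f (Q.transition t x) ∧
        ∫ y, f y ∂(Q.transition t x) =
          f x + 1 / 2 * ∫ u in (0 : ℝ)..t,
            ∫ y, secondDeriv f y ∂(Q.transition u.toNNReal x)) :
    ∀ (t : ℝ≥0) (f : C₀(StarGraph N, ℝ)) (x : StarGraph N),
      Q.op t f x = walshSemigroup α t f x := by
  intro t f x
  rcases eq_or_ne t 0 with rfl | ht
  · simp [walshSemigroup, Q.op_zero]
  -- The constant `1` is the case `s = 0` of the eigenfunctions; its equation yields
  -- conservativeness.
  have hone : ∀ y : StarGraph N, trigFun 0 1 0 y = 1 := fun y => by simp [trigFun]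
  have hprob : ∀ u, IsProbabilityMeasure (Q.transition u x) := fun u => by
    obtain ⟨h1, h2⟩ := hQ _ (trigFun_mem_walshDomain (α := α) 0 1 0 (by simp)) u x
    simp only [secondDeriv_trigFun] at h2
    simp only [funext hone] at h1 h2
    have : IsFiniteMeasure (Q.transition u x) := by
      simpa [integrable_const_iff] using h1
    refine ⟨?_⟩
    simpa [measureReal_def, ENNReal.toReal_eq_one_iff] using h2
  have htr : HasWalshTransform α t x (Q.transition t x) := by
    intro A B s hA
    -- The rate `s ^ 2 / 2` is the factor `1 / 2` times the eigenvalue `s ^ 2` of `-f''`.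
    have h := eq_exp_of_eq_sub_mul_integral (y₀ := trigFun A B s x) (c := s ^ 2 / 2)
      (y := fun u => ∫ y, trigFun A B s y ∂(Q.transition u.toNNReal x))
      (C := ∑ i, |A i| + |B|) (fun u => ?_) (fun u hu => ?_) t t.2
    · simp only [Real.toNNReal_coe] at h
      rw [h, mul_comm]
    · simpa using norm_integral_le_of_norm_le_const (μ := Q.transition u.toNNReal x)
        (f := trigFun A B s) (ae_of_all _ (abs_trigFun_le A B s))
    · have h2 := (hQ _ (trigFun_mem_walshDomain A B s hA) u.toNNReal x).2
      simp only [secondDeriv_trigFun, integral_const_mul, intervalIntegral.integral_const_mul,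
        Real.coe_toNNReal _ hu] at h2
      rw [h2]
      ring
  have := hprob t
  rw [← Q.integral_transition t x f]
  exact htr.integral_eq hα1 ht f.continuous fun y => f.toBCF.norm_coe_le_norm y
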